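/- **Setting.** All Hilbert spaces are complex and separable. For a Hilbert space $\mathcal Y$, let $H_d^2(\mathcal Y)$ be the reproducing kernel Hilbert space of $\mathcal Y$-valued functions on the open Euclidean unit ball $\mathbb B_d\subset\mathbb C^d$ with kernel $I_{\mathcal Y}/(1-\langle z,w\rangle)$, and let $M_{z_j}$ denote multiplication by $z_j$ on it. The Schur class $\mathcal S_d(\mathcal U,\mathcal Y)$ consists of the holomorphic functions $\varphi:\mathbb B_d\to\mathcal B(\mathcal U,\mathcal Y)$ for which $f\mapsto\varphi f$ maps $H_d^2(\mathcal U)$ into $H_d^2(\mathcal Y)$ with norm at most $1$. For such $\varphi$, let $H(k_\varphi)$ be the reproducing kernel Hilbert space with kernel $k_\varphi(z,w)=\dfrac{I_{\mathcal Y}-\varphi(z)\varphi(w)^*}{1-\langle z,w\rangle}$, and let $\mathcal U_\varphi^0=\{u\in\mathcal U:\varphi(z)u=0\text{ for all }z\in\mathbb B_d\}$. A *colligation* is a bounded operator $U=\begin{pmatrix}A&B\\C&D\end{pmatrix}:K\oplus\mathcal U\to K^d\oplus\mathcal Y$, where $K$ is a Hilbert space and $A=(A_1,\dots,A_d)^T$;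 it is *coisometric* if $UU^*=I$. It *realizes* $\varphi$ if for every $z\in\mathbb B_d$ the operator $I-ZA$ is invertible and $\varphi(z)=D+C(I-ZA)^{-1}ZB$, where $Z=(z_1I_K,\dots,z_dI_K):K^d\to K$. A *functional model realization* of $\varphi$ is a colligation with $K=H(k_\varphi)$ that realizes $\varphi$ and satisfies $A_j=M_{z_j}^*|_{H(k_\varphi)}$ for $j=1,\dots,d$ (where $M_{z_j}^*$ is the adjoint of $M_{z_j}$ on $H_d^2(\mathcal Y)$, and elements of $H(k_\varphi)$ and $H_d^2(\mathcal Y)$ are compared as functions), $Cf=f(0)$ for $f\in H(k_\varphi)$, and $D=\varphi(0)$. For a Hilbert space $\mathcal M$, let $U_{\mathcal M}=\begin{pmatrix}A&B&0\\C&D&0\end{pmatrix}:K\oplus\mathcal U\oplus\mathcal M\to K^d\oplus\mathcal Y$. Two colligations $U_i:K_i\oplus\mathcal U_i\to K_i^d\oplus\mathcal Y_i$ ($i=1,2$) are *unitarily coincident* if there are unitary operators $\Lambda:K_1\to K_2$, $\Omega_1:\mathcal U_1\to\mathcal U_2$ and $\Omega_2:\mathcal Y_1\to\mathcal Y_2$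 with $(\Lambda^d\oplus\Omega_2)U_1=U_2(\Lambda\oplus\Omega_1)$. A function $\varphi\in\mathcal S_d(\mathcal U,\mathcal Y)$ *coincides* with $\psi\in\mathcal S_d(\mathcal V,\mathcal W)$ if there are unitary operators $\alpha:\mathcal U\to\mathcal V$ and $\beta:\mathcal Y\to\mathcal W$ with $\beta\varphi(z)=\psi(z)\alpha$ for all $z\in\mathbb B_d$. **Theorem 3.2.** Let $\varphi\in\mathcal S_d(\mathcal U,\mathcal Y)$ and $\psi\in\mathcal S_d(\mathcal V,\mathcal W)$ both admit coisometric functional model realizations. Then the following are equivalent: 1. $\varphi$ coincides with $\psi$. 2. $\dim\mathcal U_\varphi^0=\dim\mathcal V_\psi^0$ (Hilbert space dimensions), and for every coisometric functional model realization $U^\varphi$ of $\varphi$ and every coisometric functional model realization $U^\psi$ of $\psi$ there exists a Hilbert space $\mathcal M$ such that $U^\varphi_{\mathcal M}$ is unitarily coincident to $U^\psi$ or $U^\psi_{\mathcal M}$ is unitarily coincident to $U^\varphi$. -/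

import Mathlib

open scoped InnerProductSpace

universe u v w y

namespace DruryArveson

/-- The open Euclidean unit ball of `ℂ^d`. -/
abbrev Ball (d : ℕ) : Type := Metric.ball (0 : EuclideanSpace ℂ (Fin d)) 1

/-! ### The Drury-Arveson kernel -/

/-- The scalar kernel `1 / (1 - ⟨z, w⟩)`. Mathlib's inner product is conjugate-linear in its first
argument, so that `⟨z, w⟩ = ∑ z_j * conj w_j` is written `⟪w, z⟫_ℂ`. -/
noncomputable def scalarKernel (d : ℕ) (z w : Ball d) : ℂ :=
  (1 - ⟪(w : EuclideanSpace ℂ (Fin d)), (z : EuclideanSpace ℂ (Fin d))⟫_ℂ)⁻¹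

/-- The operator-valued kernel `I / (1 - ⟨z, w⟩)`. -/
noncomputable def szegoKernel (d : ℕ) (Y : Type*) [NormedAddCommGroup Y] [InnerProductSpace ℂ Y] :
    Matrix (Ball d) (Ball d) (Y →L[ℂ] Y) :=
  Matrix.of fun z w => scalarKernel d z w • ContinuousLinearMap.id ℂ Y

section Positivity

variable {d : ℕ} {Y : Type*} [NormedAddCommGroup Y] [InnerProductSpace ℂ Y] {ι : Type*}

/-- The quadratic form of a scalar kernel `c` (tensored with `I_Y`). -/
noncomputable def gram (c : Ball d → Ball d → ℂ) (s : Finset ι) (x : ι → Ball d) (v : ι → Y) : ℝ :=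
  RCLike.re (∑ i ∈ s, ∑ j ∈ s, ⟪c (x j) (x i) • v i, v j⟫_ℂ)

theorem gram_one (s : Finset ι) (x : ι → Ball d) (v : ι → Y) :
    gram (fun _ _ => 1) s x v = ‖∑ i ∈ s, v i‖ ^ 2 := by
  rw [← inner_self_eq_norm_sq (𝕜 := ℂ)]
  simp only [gram, one_smul, sum_inner, inner_sum]
  rw [Finset.sum_comm]

theorem gram_add (c c' : Ball d → Ball d → ℂ) (s : Finset ι) (x : ι → Ball d) (v : ι → Y) :
    gram (fun z w => c z w + c' z w) s x v = gram c s x v + gram c' s x v := by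
  simp only [gram, add_smul, inner_add_left, Finset.sum_add_distrib, map_add]

theorem gram_sum {κ : Type*} (t : Finset κ) (c : κ → Ball d → Ball d → ℂ) (s : Finset ι)
    (x : ι → Ball d) (v : ι → Y) :
    gram (fun z w => ∑ k ∈ t, c k z w) s x v = ∑ k ∈ t, gram (c k) s x v := by
  classical
  induction t using Finset.induction_on with
  | empty => simp [gram]
  | insert a t ha ih => simp only [Finset.sum_insert ha, gram_add, ih]

theorem gram_coord (c : Ball d → Ball d → ℂ) (m : Ball d → ℂ) (s : Finset ι)
    (x : ι → Ball d) (v : ι → Y) :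
    gram (fun z w => m z * star (m w) * c z w) s x v =
      gram c s x (fun i => star (m (x i)) • v i) := by
  unfold gram
  congr 1
  refine Finset.sum_congr rfl fun i _ => Finset.sum_congr rfl fun j _ => ?_
  simp only [inner_smul_left, inner_smul_right, map_mul, RCLike.star_def, RCLike.conj_conj]
  ring

theorem inner_eq_sum (z w : Ball d) :
    ⟪(w : EuclideanSpace ℂ (Fin d)), (z : EuclideanSpace ℂ (Fin d))⟫_ℂ =
      ∑ k, z.1 k * star (w.1 k) := by
  simp [PiLp.inner_apply]

theorem gram_pow_nonneg (n : ℕ) (s : Finset ι) (x : ι → Ball d) (v : ι → Y) :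
    0 ≤ gram (fun z w => ⟪(w : EuclideanSpace ℂ (Fin d)), (z : EuclideanSpace ℂ (Fin d))⟫_ℂ ^ n)
      s x v := by
  induction n generalizing v with
  | zero => simp only [pow_zero, gram_one]; positivity
  | succ n ih =>
    have h : (fun z w : Ball d =>
        ⟪(w : EuclideanSpace ℂ (Fin d)), (z : EuclideanSpace ℂ (Fin d))⟫_ℂ ^ (n + 1)) =
        fun z w : Ball d => ∑ k, z.1 k * star (w.1 k) *
          ⟪(w : EuclideanSpace ℂ (Fin d)), (z : EuclideanSpace ℂ (Fin d))⟫_ℂ ^ n := by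
      funext z w
      rw [pow_succ', ← Finset.sum_mul, ← inner_eq_sum]
    rw [h, gram_sum]
    refine Finset.sum_nonneg fun k _ => ?_
    rw [gram_coord _ (fun z : Ball d => z.1 k)]
    exact ih _

theorem norm_inner_lt_one (z w : Ball d) :
    ‖⟪(w : EuclideanSpace ℂ (Fin d)), (z : EuclideanSpace ℂ (Fin d))⟫_ℂ‖ < 1 := by
  have hz : ‖(z : EuclideanSpace ℂ (Fin d))‖ < 1 := mem_ball_zero_iff.mp z.2
  have hw : ‖(w : EuclideanSpace ℂ (Fin d))‖ < 1 := mem_ball_zero_iff.mp w.2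
  refine (norm_inner_le_norm _ _).trans_lt ?_
  nlinarith [norm_nonneg (z : EuclideanSpace ℂ (Fin d)),
    norm_nonneg (w : EuclideanSpace ℂ (Fin d))]

theorem gram_scalarKernel_nonneg (s : Finset ι) (x : ι → Ball d) (v : ι → Y) :
    0 ≤ gram (scalarKernel d) s x v := by
  have hc : ∀ z w : Ball d, Filter.Tendsto (fun N => ∑ n ∈ Finset.range N,
      ⟪(w : EuclideanSpace ℂ (Fin d)), (z : EuclideanSpace ℂ (Fin d))⟫_ℂ ^ n) Filter.atTop
      (nhds (scalarKernel d z w)) := fun z w =>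
    (hasSum_geometric_of_norm_lt_one (norm_inner_lt_one z w)).tendsto_sum_nat
  have h : Filter.Tendsto (fun N => gram (fun z w => ∑ n ∈ Finset.range N,
      ⟪(w : EuclideanSpace ℂ (Fin d)), (z : EuclideanSpace ℂ (Fin d))⟫_ℂ ^ n) s x v) Filter.atTop
      (nhds (gram (scalarKernel d) s x v)) := by
    unfold gram
    refine (RCLike.continuous_re.tendsto _).comp ?_
    refine tendsto_finsetSum _ fun i _ => tendsto_finsetSum _ fun j _ => ?_
    exact ((hc _ _).smul_const _).inner tendsto_const_nhds
  refine ge_of_tendsto' h fun N => ?_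
  rw [gram_sum]
  exact Finset.sum_nonneg fun n _ => gram_pow_nonneg n s x v

/-- Positivity of `(1 - z_k * conj w_k) / (1 - ⟨z, w⟩)`: multiplication by `z_k` is contractive. -/
theorem gram_coord_le (k : Fin d) (s : Finset ι) (x : ι → Ball d) (v : ι → Y) :
    gram (scalarKernel d) s x (fun i => star ((x i).1 k) • v i) ≤ gram (scalarKernel d) s x v := by
  classical
  have h : scalarKernel d = fun z w : Ball d =>
      (1 + ∑ l ∈ Finset.univ.erase k, z.1 l * star (w.1 l) * scalarKernel d z w) +
        z.1 k * star (w.1 k) * scalarKernel d z w := by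
    funext z w
    have hne : 1 - ⟪(w : EuclideanSpace ℂ (Fin d)), (z : EuclideanSpace ℂ (Fin d))⟫_ℂ ≠ 0 := by
      intro h0
      have := norm_inner_lt_one z w
      rw [← sub_eq_zero.mp h0] at this
      simp at this
    rw [add_assoc, Finset.sum_erase_add _ _ (Finset.mem_univ k), ← Finset.sum_mul, ← inner_eq_sum]
    unfold scalarKernel
    field_simp
    ring
  conv_rhs => rw [h]
  rw [gram_add, gram_add, gram_one, gram_sum, gram_coord _ (fun z : Ball d => z.1 k)]
  have : 0 ≤ ∑ l ∈ Finset.univ.erase k,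
      gram (fun z w : Ball d => z.1 l * star (w.1 l) * scalarKernel d z w) s x v :=
    Finset.sum_nonneg fun l _ => by
      rw [gram_coord _ (fun z : Ball d => z.1 l)]
      exact gram_scalarKernel_nonneg _ _ _
  nlinarith [sq_nonneg ‖∑ i ∈ s, v i‖]

theorem scalarKernel_conj (z w : Ball d) : star (scalarKernel d z w) = scalarKernel d w z := by
  simp only [scalarKernel, star_inv₀, star_sub, star_one, RCLike.star_def]
  rw [inner_conj_symm]

end Positivity

section Hardy

variable (d : ℕ) (Y : Type*) [NormedAddCommGroup Y] [InnerProductSpace ℂ Y] [CompleteSpace Y]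

instance szegoKernel_posSemidef : Fact (szegoKernel d Y).PosSemidef := ⟨by
  have h := (RKHS.posSemidef_tfae (K := szegoKernel d Y)).out 0 2
  refine h.mpr ⟨?_, fun v => ?_⟩
  · ext1 z w
    simp only [szegoKernel, Matrix.conjTranspose_apply, Matrix.of_apply, star_smul,
      scalarKernel_conj]
    congr 1
    exact star_one (Y →L[ℂ] Y)
  · exact gram_scalarKernel_nonneg v.support (fun z => z) v⟩

/-- The Drury-Arveson space `H_d^2(Y)`: the reproducing kernel Hilbert space of `Y`-valued functions
on the ball with kernel `I_Y / (1 - ⟨z, w⟩)`. -/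
noncomputable abbrev H2 : Type _ := RKHS.OfKernel (szegoKernel d Y)

variable {d Y}

theorem norm_sum_kerFun {ι : Type*} (s : Finset ι) (x : ι → Ball d) (v : ι → Y) :
    ‖∑ i ∈ s, RKHS.kerFun (H2 d Y) (x i) (v i)‖ ^ 2 = gram (scalarKernel d) s x v := by
  rw [← inner_self_eq_norm_sq (𝕜 := ℂ)]
  simp only [gram, sum_inner, inner_sum]
  rw [Finset.sum_comm]
  congr 1
  refine Finset.sum_congr rfl fun i _ => Finset.sum_congr rfl fun j _ => ?_
  rw [RKHS.inner_kerFun, RKHS.kerFun_apply, RKHS.OfKernel.kernel_ofKernel]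
  rfl

theorem exists_coordMul (k : Fin d) : ∃ T : H2 d Y →L[ℂ] H2 d Y,
    ∀ (f : H2 d Y) (z : Ball d), T f z = z.1 k • f z := by
  let e : (Ball d × Y →₀ ℂ) →ₗ[ℂ] H2 d Y :=
    Finsupp.linearCombination ℂ fun p : Ball d × Y => RKHS.kerFun (H2 d Y) p.1 p.2
  let g : (Ball d × Y →₀ ℂ) →ₗ[ℂ] H2 d Y :=
    Finsupp.linearCombination ℂ fun p : Ball d × Y =>
      star (p.1.1 k) • RKHS.kerFun (H2 d Y) p.1 p.2
  have hdense : DenseRange e := by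
    have h := RKHS.kerFun_dense (𝕜 := ℂ) (X := Ball d) (V := Y) (H2 d Y)
    rw [← Submodule.dense_iff_topologicalClosure_eq_top] at h
    refine h.mono ?_
    rw [← LinearMap.coe_range, SetLike.coe_subset_coe, Submodule.span_le]
    rintro _ ⟨z, y, rfl⟩
    exact ⟨Finsupp.single (z, y) 1, by simp [e]⟩
  have hnorm : ∀ F, ‖g F‖ ≤ 1 * ‖e F‖ := by
    intro F
    have h1 : e F = ∑ p ∈ F.support, RKHS.kerFun (H2 d Y) p.1 (F p • p.2) := by
      simp [e, Finsupp.linearCombination_apply, Finsupp.sum]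
    have h2 : g F = ∑ p ∈ F.support,
        RKHS.kerFun (H2 d Y) p.1 (star (p.1.1 k) • (F p • p.2)) := by
      simp only [g, Finsupp.linearCombination_apply, Finsupp.sum, map_smul]
      exact Finset.sum_congr rfl fun p _ => smul_comm _ _ _
    rw [one_mul, ← sq_le_sq₀ (norm_nonneg _) (norm_nonneg _), h1, h2, norm_sum_kerFun,
      norm_sum_kerFun]
    exact gram_coord_le k F.support (fun p => p.1) fun p => F p • p.2
  let N : H2 d Y →L[ℂ] H2 d Y := g.extendOfNorm e
  refine ⟨N.adjoint, fun f z => ext_inner_left ℂ fun y => ?_⟩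
  have hN : N (RKHS.kerFun (H2 d Y) z y) = star (z.1 k) • RKHS.kerFun (H2 d Y) z y := by
    have h := LinearMap.extendOfNorm_eq hdense ⟨1, hnorm⟩ (Finsupp.single (z, y) (1 : ℂ))
    have h1 : e (Finsupp.single (z, y) 1) = RKHS.kerFun (H2 d Y) z y := by simp [e]
    have h2 : g (Finsupp.single (z, y) 1) = star (z.1 k) • RKHS.kerFun (H2 d Y) z y := by simp [g]
    rwa [h1, h2] at h
  rw [← RKHS.kerFun_inner, ContinuousLinearMap.adjoint_inner_right, hN, inner_smul_left,
    RKHS.kerFun_inner, inner_smul_right]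
  simp

/-- The coordinate multiplier `M_{z_k}` on `H_d^2(Y)`, i.e. `(M_{z_k} f)(z) = z_k f(z)`; it is
characterized by `coordMul_apply`. -/
noncomputable def coordMul (k : Fin d) : H2 d Y →L[ℂ] H2 d Y := (exists_coordMul k).choose

theorem coordMul_apply (k : Fin d) (f : H2 d Y) (z : Ball d) : coordMul k f z = z.1 k • f z :=
  (exists_coordMul k).choose_spec f z

end Hardy

/-! ### Schur multipliers and their de Branges-Rovnyak spaces -/

/-- The Schur class `S_d(U, Y)`: holomorphic `B(U, Y)`-valued functions `φ` on the ball such that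
`f ↦ φ f` maps `H_d^2(U)` into `H_d^2(Y)` with norm at most `1`. -/
structure SchurMultiplier (d : ℕ) (U Y : Type*) [NormedAddCommGroup U] [InnerProductSpace ℂ U]
    [CompleteSpace U] [NormedAddCommGroup Y] [InnerProductSpace ℂ Y] [CompleteSpace Y] where
  /-- the underlying operator-valued function on the ball -/
  toFun : Ball d → (U →L[ℂ] Y)
  /-- `φ` is holomorphic -/
  holomorphic : ∃ F : EuclideanSpace ℂ (Fin d) → (U →L[ℂ] Y),
    DifferentiableOn ℂ F (Metric.ball 0 1) ∧ ∀ z : Ball d, F z = toFun z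
  /-- `φ` is a multiplier, and its multiplication operator is a contraction -/
  contractive : ∀ f : H2 d U, ∃ g : H2 d Y, (∀ z, g z = toFun z (f z)) ∧ ‖g‖ ≤ ‖f‖

namespace SchurMultiplier

variable {d : ℕ} {U Y : Type*} [NormedAddCommGroup U] [InnerProductSpace ℂ U]
  [CompleteSpace U] [NormedAddCommGroup Y] [InnerProductSpace ℂ Y] [CompleteSpace Y]

instance : CoeFun (SchurMultiplier d U Y) fun _ => Ball d → (U →L[ℂ] Y) := ⟨toFun⟩

/-- The kernel `k_φ(z, w) = (I - φ(z) φ(w)^*) / (1 - ⟨z, w⟩)`. -/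
noncomputable def kernel (φ : SchurMultiplier d U Y) : Matrix (Ball d) (Ball d) (Y →L[ℂ] Y) :=
  Matrix.of fun z w => scalarKernel d z w •
    (ContinuousLinearMap.id ℂ Y - φ z ∘L ContinuousLinearMap.adjoint (φ w))

instance kernel_posSemidef (φ : SchurMultiplier d U Y) : Fact φ.kernel.PosSemidef := ⟨by
  have h := (RKHS.posSemidef_tfae (K := φ.kernel)).out 0 2
  refine h.mpr ⟨?_, fun v => ?_⟩
  · ext1 z w
    simp only [kernel, Matrix.conjTranspose_apply, Matrix.of_apply, star_smul,
      scalarKernel_conj, star_sub]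
    congr 2
    · exact star_one (Y →L[ℂ] Y)
    · rw [ContinuousLinearMap.star_eq_adjoint, ContinuousLinearMap.adjoint_comp,
        ContinuousLinearMap.adjoint_adjoint]
  · let F : H2 d U := ∑ i ∈ v.support,
      RKHS.kerFun (H2 d U) i (ContinuousLinearMap.adjoint (φ i) (v i))
    let G : H2 d Y := ∑ i ∈ v.support, RKHS.kerFun (H2 d Y) i (v i)
    obtain ⟨g, hg, hle⟩ := φ.contractive F
    have h1 : ⟪F, F⟫_ℂ = ⟪g, G⟫_ℂ := by
      conv_lhs => rw [show F = ∑ i ∈ v.support,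
        RKHS.kerFun (H2 d U) i (ContinuousLinearMap.adjoint (φ i) (v i)) from rfl, inner_sum]
      rw [inner_sum]
      refine Finset.sum_congr rfl fun i _ => ?_
      rw [RKHS.inner_kerFun, RKHS.inner_kerFun, hg, ContinuousLinearMap.adjoint_inner_right]
    have h2 : ‖F‖ ≤ ‖G‖ := by
      have h3 : ‖F‖ ^ 2 ≤ ‖F‖ * ‖G‖ := by
        rw [← inner_self_eq_norm_sq (𝕜 := ℂ), h1]
        exact (re_inner_le_norm _ _).trans (mul_le_mul_of_nonneg_right hle (norm_nonneg _))
      by_contra hlt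
      push Not at hlt
      nlinarith [norm_nonneg G, norm_nonneg F]
    have h4 : ‖F‖ ^ 2 ≤ ‖G‖ ^ 2 := by gcongr
    rw [norm_sum_kerFun v.support (fun z => z) fun z => ContinuousLinearMap.adjoint (φ z) (v z),
      norm_sum_kerFun v.support (fun z => z) v, ← sub_nonneg] at h4
    refine h4.trans_eq ?_
    simp only [gram, Finsupp.sum, ← map_sub, ← Finset.sum_sub_distrib]
    congr 1
    refine Finset.sum_congr rfl fun i _ => Finset.sum_congr rfl fun j _ => ?_
    simp only [kernel, Matrix.of_apply, smul_apply, sub_apply,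
      ContinuousLinearMap.id_apply, ContinuousLinearMap.comp_apply, smul_sub, inner_sub_left,
      inner_smul_left, map_smul, ContinuousLinearMap.adjoint_inner_right]⟩

/-- The de Branges-Rovnyak space `H(k_φ)`: the reproducing kernel Hilbert space of `Y`-valued
functions on the ball with kernel `k_φ`. -/
noncomputable abbrev space (φ : SchurMultiplier d U Y) : Type _ := RKHS.OfKernel φ.kernel

/-- The closed subspace `U_φ^0` of all `u` with `φ(z) u = 0` for every `z`. -/
def nullSpace (φ : SchurMultiplier d U Y) : Submodule ℂ U :=
  ⨅ z : Ball d, (φ z).ker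

theorem mem_nullSpace (φ : SchurMultiplier d U Y) (u : U) :
    u ∈ φ.nullSpace ↔ ∀ z, φ z u = 0 := by
  simp [nullSpace]

instance (φ : SchurMultiplier d U Y) : CompleteSpace φ.nullSpace := by
  have h : IsClosed (φ.nullSpace : Set U) := by
    simp only [nullSpace, Submodule.coe_iInf]
    exact isClosed_iInter fun z => (φ z).isClosed_ker
  exact h.completeSpace_coe

/-- Coincidence of Schur multipliers: `β φ(z) = ψ(z) α` for some unitaries `α` and `β`. -/
def Coincides {V W : Type*} [NormedAddCommGroup V] [InnerProductSpace ℂ V]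
    [CompleteSpace V] [NormedAddCommGroup W] [InnerProductSpace ℂ W] [CompleteSpace W]
    (φ : SchurMultiplier d U Y) (ψ : SchurMultiplier d V W) : Prop :=
  ∃ (α : U ≃ₗᵢ[ℂ] V) (β : Y ≃ₗᵢ[ℂ] W), ∀ (z : Ball d) (u : U), β (φ z u) = ψ z (α u)

end SchurMultiplier

/-- The Hilbert space dimension: the cardinality of an orthonormal (Hilbert) basis. -/
noncomputable def hilbertDim (E : Type*) [NormedAddCommGroup E] [InnerProductSpace ℂ E]
    [CompleteSpace E] : Cardinal :=
  Cardinal.mk (exists_hilbertBasis ℂ E).choose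

/-! ### Colligations -/

/-- The Hilbert space direct sum of two operators. -/
noncomputable def directSum {E F E' F' : Type*}
    [NormedAddCommGroup E] [InnerProductSpace ℂ E] [NormedAddCommGroup F] [InnerProductSpace ℂ F]
    [NormedAddCommGroup E'] [InnerProductSpace ℂ E'] [NormedAddCommGroup F']
    [InnerProductSpace ℂ F'] (S : E →L[ℂ] E') (T : F →L[ℂ] F') :
    WithLp 2 (E × F) →L[ℂ] WithLp 2 (E' × F') :=
  (WithLp.prodContinuousLinearEquiv 2 ℂ E' F').symm.toContinuousLinearMap ∘L
    (S.prodMap T) ∘L (WithLp.prodContinuousLinearEquiv 2 ℂ E F).toContinuousLinearMap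

/-- A colligation: bounded operators `A : K → K^d`, `B : U → K^d`, `C : K → Y`, `D : U → Y`, that
is, the entries of a block operator matrix `K ⊕ U → K^d ⊕ Y`. -/
structure Colligation (d : ℕ) (K U Y : Type*) [NormedAddCommGroup K] [InnerProductSpace ℂ K]
    [NormedAddCommGroup U] [InnerProductSpace ℂ U]
    [NormedAddCommGroup Y] [InnerProductSpace ℂ Y] where
  /-- the column `(A_1, …, A_d)` -/
  A : K →L[ℂ] PiLp 2 (fun _ : Fin d => K)
  /-- the column `(B_1, …, B_d)` -/
  B : U →L[ℂ] PiLp 2 (fun _ : Fin d => K)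
  /-- the output operator -/
  C : K →L[ℂ] Y
  /-- the feedthrough operator -/
  D : U →L[ℂ] Y

namespace Colligation

section Basic

variable {d : ℕ} {K U Y : Type*} [NormedAddCommGroup K] [InnerProductSpace ℂ K]
  [NormedAddCommGroup U] [InnerProductSpace ℂ U] [NormedAddCommGroup Y] [InnerProductSpace ℂ Y]

/-- The connecting operator `[[A, B], [C, D]] : K ⊕ U → K^d ⊕ Y`. -/
noncomputable def toCLM (S : Colligation d K U Y) :
    WithLp 2 (K × U) →L[ℂ] WithLp 2 (PiLp 2 (fun _ : Fin d => K) × Y) :=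
  (WithLp.prodContinuousLinearEquiv 2 ℂ (PiLp 2 (fun _ : Fin d => K)) Y).symm.toContinuousLinearMap
    ∘L ((S.A.coprod S.B).prod (S.C.coprod S.D)) ∘L
    (WithLp.prodContinuousLinearEquiv 2 ℂ K U).toContinuousLinearMap

/-- The connecting operator is coisometric. -/
def IsCoisometric [CompleteSpace K] [CompleteSpace U] [CompleteSpace Y]
    (S : Colligation d K U Y) : Prop :=
  S.toCLM ∘L ContinuousLinearMap.adjoint S.toCLM = ContinuousLinearMap.id ℂ _

/-- The row operator `Z = (z_1 I, …, z_d I) : K^d → K`. -/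
noncomputable def rowOp (K : Type*) [NormedAddCommGroup K] [InnerProductSpace ℂ K]
    (z : Ball d) : PiLp 2 (fun _ : Fin d => K) →L[ℂ] K :=
  ∑ j, z.1 j • PiLp.proj 2 (fun _ : Fin d => K) j

/-- `S` realizes the function `φ` on the ball: `I - Z A` is invertible and
`φ(z) = D + C (I - Z A)⁻¹ Z B`. -/
def Realizes (S : Colligation d K U Y) (φ : Ball d → (U →L[ℂ] Y)) : Prop :=
  ∀ z : Ball d, IsUnit (1 - rowOp K z ∘L S.A : K →L[ℂ] K) ∧
    φ z = S.D + S.C ∘L Ring.inverse (1 - rowOp K z ∘L S.A : K →L[ℂ] K) ∘L rowOp K z ∘L S.B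

/-- The colligation `[[A, B, 0], [C, D, 0]]` with input space `U ⊕ M`. -/
noncomputable def pad (S : Colligation d K U Y) (M : Type*) [NormedAddCommGroup M]
    [InnerProductSpace ℂ M] : Colligation d K (WithLp 2 (U × M)) Y where
  A := S.A
  B := S.B ∘L WithLp.fstL 2 ℂ U M
  C := S.C
  D := S.D ∘L WithLp.fstL 2 ℂ U M

/-- Unitary coincidence of colligations: there are unitaries `Λ`, `Ω₁`, `Ω₂` such that
`(Λ^d ⊕ Ω₂) S = T (Λ ⊕ Ω₁)`. -/
def UnitarilyCoincident {L V W : Type*} [NormedAddCommGroup L] [InnerProductSpace ℂ L]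
    [NormedAddCommGroup V] [InnerProductSpace ℂ V] [NormedAddCommGroup W] [InnerProductSpace ℂ W]
    (S : Colligation d K U Y) (T : Colligation d L V W) : Prop :=
  ∃ (Λ : K ≃ₗᵢ[ℂ] L) (Ω₁ : U ≃ₗᵢ[ℂ] V) (Ω₂ : Y ≃ₗᵢ[ℂ] W),
    directSum (LinearIsometryEquiv.piLpCongrRight 2 (fun _ : Fin d => Λ) :
        PiLp 2 (fun _ : Fin d => K) →L[ℂ] PiLp 2 (fun _ : Fin d => L)) (Ω₂ : Y →L[ℂ] W) ∘L S.toCLM =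
      T.toCLM ∘L directSum (Λ : K →L[ℂ] L) (Ω₁ : U →L[ℂ] V)

end Basic

variable {d : ℕ} {U Y : Type*} [NormedAddCommGroup U] [InnerProductSpace ℂ U]
  [CompleteSpace U] [NormedAddCommGroup Y] [InnerProductSpace ℂ Y] [CompleteSpace Y]

/-- A functional model realization of `φ`: a realization of `φ` with state space `H(k_φ)` such that
`A_j` is the restriction to `H(k_φ)` of the backward shift `M_{z_j}^*` of `H_d^2(Y)` (elements of
the two spaces being identified when they are equal as functions), `C f = f(0)`, and
`D = φ(0)`. -/
structure IsFunctionalModel (φ : SchurMultiplier d U Y) (S : Colligation d φ.space U Y) :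
    Prop where
  realizes : S.Realizes φ
  A_eq : ∀ (j : Fin d) (f : φ.space), ∃ F : H2 d Y, (∀ z, F z = f z) ∧
    ∀ z, (S.A f j : φ.space) z = ContinuousLinearMap.adjoint (coordMul j) F z
  C_eq : ∀ f : φ.space, S.C f = f ⟨0, by simp⟩
  D_eq : S.D = φ ⟨0, by simp⟩

/-- A coisometric functional model realization of `φ`. -/
structure IsCoisometricFunctionalModel (φ : SchurMultiplier d U Y)
    (S : Colligation d φ.space U Y) : Prop extends IsFunctionalModel φ S where
  coisometric : S.IsCoisometric

end Colligation

end DruryArveson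

/-!
The first column `(A, C)` of a functional model of `φ` is determined by `φ`, and so is
`(B, D) (B, D)^* = I - (A, C) (A, C)^*` when the model is coisometric. The second column `(B, D)` is
therefore determined up to a partial isometry of the input space, that is, up to a unitary and the
dimension of its kernel (`exists_unitary_factor`, a form of Douglas' lemma).

If `φ` coincides with `ψ`, with output unitary `β`, then `f ↦ β ∘ f` identifies `H(k_φ)` with
`H(k_ψ)` (`SchurMultiplier.exists_space_comp`) and the first columns of the models
(`IsFunctionalModel.stateOp_comp`). Of the kernels of the second columns, one embeds
isometrically into the other; padding by a copy `M` of the complement makes them unitarily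
equivalent, and the second columns then differ by a unitary
(`IsCoisometric.pad_unitarilyCoincident`).

Conversely, a coincidence of a padded model of `φ` with a model of `ψ` gives
`ψ(z) Ω₁ = Ω₂ [φ(z), 0]`, so that `ψ(z) ψ(w)^* = Ω₂ φ(z) φ(w)^* Ω₂^*`. Douglas' lemma, now for
families indexed by the ball, has the null spaces of `φ` and `ψ` as common kernels; when these have
the same dimension it yields a unitary `α` with `Ω₂ φ(z) = ψ(z) α`
(`coincides_of_pad_unitarilyCoincident`).
-/

/-! ### Unitaries between separable Hilbert spaces -/

section Hilbert

variable {E : Type*} [NormedAddCommGroup E] [InnerProductSpace ℂ E]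
  {F : Type*} [NormedAddCommGroup F] [InnerProductSpace ℂ F] {ι κ : Type*}

theorem topologicalClosure_span_range_eq_top [CompleteSpace E] {a : ι → E}
    (ha : ∀ x, (∀ i, ⟪a i, x⟫_ℂ = 0) → x = 0) :
    (Submodule.span ℂ (Set.range a)).topologicalClosure = ⊤ := by
  rw [Submodule.topologicalClosure_eq_top_iff, Submodule.eq_bot_iff]
  intro x hx
  exact ha x fun i => (Submodule.mem_orthogonal _ _).mp hx _ (Submodule.subset_span ⟨i, rfl⟩)

/-- A total family is carried isometrically onto any family with the same Gram matrix. -/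
theorem exists_linearIsometry_of_inner_eq [CompleteSpace E] [CompleteSpace F] {a : ι → E}
    {b : ι → F} (ha : ∀ x, (∀ i, ⟪a i, x⟫_ℂ = 0) → x = 0)
    (hab : ∀ i j, ⟪a i, a j⟫_ℂ = ⟪b i, b j⟫_ℂ) :
    ∃ J : E →ₗᵢ[ℂ] F, ∀ i, J (a i) = b i := by
  let e : (ι →₀ ℂ) →ₗ[ℂ] E := Finsupp.linearCombination ℂ a
  let g : (ι →₀ ℂ) →ₗ[ℂ] F := Finsupp.linearCombination ℂ b
  have hdense : DenseRange e := by
    have h := topologicalClosure_span_range_eq_top ha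
    rwa [← Submodule.dense_iff_topologicalClosure_eq_top, ← Finsupp.range_linearCombination] at h
  have hnorm : ∀ x, ‖g x‖ = ‖e x‖ := by
    intro x
    rw [← sq_eq_sq₀ (norm_nonneg _) (norm_nonneg _), ← inner_self_eq_norm_sq (𝕜 := ℂ),
      ← inner_self_eq_norm_sq (𝕜 := ℂ)]
    simp only [e, g, Finsupp.linearCombination_apply, Finsupp.sum, sum_inner, inner_sum,
      inner_smul_left, inner_smul_right, hab]
  have hbound : ∀ x, ‖g x‖ ≤ 1 * ‖e x‖ := fun x => by rw [one_mul, hnorm]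
  let N : E →L[ℂ] F := g.extendOfNorm e
  have hN : ∀ x, N (e x) = g x := fun x => LinearMap.extendOfNorm_eq hdense ⟨1, hbound⟩ x
  refine ⟨⟨N.toLinearMap, fun x => ?_⟩, fun i => ?_⟩
  · refine hdense.induction_on (p := fun x => ‖N x‖ = ‖x‖) x
      (isClosed_eq (by fun_prop) (by fun_prop)) fun x => ?_
    rw [hN, hnorm]
  · simpa [e, g] using hN (Finsupp.single i 1)

/-- Two total families with the same Gram matrix are unitarily equivalent. -/
theorem exists_linearIsometryEquiv_of_inner_eq [CompleteSpace E] [CompleteSpace F] {a : ι → E}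
    {b : ι → F} (ha : ∀ x, (∀ i, ⟪a i, x⟫_ℂ = 0) → x = 0)
    (hb : ∀ x, (∀ i, ⟪b i, x⟫_ℂ = 0) → x = 0)
    (hab : ∀ i j, ⟪a i, a j⟫_ℂ = ⟪b i, b j⟫_ℂ) :
    ∃ J : E ≃ₗᵢ[ℂ] F, ∀ i, J (a i) = b i := by
  obtain ⟨J, hJ⟩ := exists_linearIsometry_of_inner_eq ha hab
  have hsurj : Function.Surjective J := by
    have hle : (Submodule.span ℂ (Set.range b)).topologicalClosure ≤
        LinearMap.range J.toLinearMap := by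
      refine Submodule.topologicalClosure_minimal _ ?_ J.isometry.isClosedEmbedding.isClosed_range
      rw [Submodule.span_le]
      rintro _ ⟨i, rfl⟩
      exact ⟨a i, hJ i⟩
    rw [topologicalClosure_span_range_eq_top hb, top_le_iff] at hle
    exact LinearMap.range_eq_top.mp hle
  exact ⟨LinearIsometryEquiv.ofSurjective J hsurj, hJ⟩

/-- The ranges of the adjoints of a family of operators together with the common kernel of the
family are total. -/
theorem eq_zero_of_inner_adjoint_of_inner_ker {N G : Type*} [NormedAddCommGroup N]
    [InnerProductSpace ℂ N] [NormedAddCommGroup G] [InnerProductSpace ℂ G] [CompleteSpace E]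
    [CompleteSpace G] {X : ι → E →L[ℂ] G} {k : N →ₗᵢ[ℂ] E}
    (hk : ∀ x, x ∈ Set.range k ↔ ∀ i, X i x = 0) (x : E)
    (hx : ∀ p, ⟪Sum.elim (fun q : ι × G => ContinuousLinearMap.adjoint (X q.1) q.2) k p, x⟫_ℂ = 0) :
    x = 0 := by
  obtain ⟨n, rfl⟩ := (hk x).mpr fun i => ext_inner_left ℂ fun g => by
    rw [inner_zero_right, ← ContinuousLinearMap.adjoint_inner_left]
    exact hx (Sum.inl (i, g))
  exact inner_self_eq_zero.mp (hx (Sum.inr n))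

/-- A form of Douglas' lemma: two families of operators with the same products `X i (X j)^*`, and
with common kernels parametrized by the same Hilbert space `N`, differ by a unitary between their
domains. -/
theorem exists_unitary_factor {N G : Type*} [NormedAddCommGroup N] [InnerProductSpace ℂ N]
    [NormedAddCommGroup G] [InnerProductSpace ℂ G]
    [CompleteSpace E] [CompleteSpace F] [CompleteSpace G]
    {X : ι → E →L[ℂ] G} {X' : ι → F →L[ℂ] G} {k : N →ₗᵢ[ℂ] E} {k' : N →ₗᵢ[ℂ] F}
    (hk : ∀ x, x ∈ Set.range k ↔ ∀ i, X i x = 0) (hk' : ∀ x, x ∈ Set.range k' ↔ ∀ i, X' i x = 0)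
    (hX : ∀ i j g h, ⟪ContinuousLinearMap.adjoint (X i) g, ContinuousLinearMap.adjoint (X j) h⟫_ℂ =
      ⟪ContinuousLinearMap.adjoint (X' i) g, ContinuousLinearMap.adjoint (X' j) h⟫_ℂ) :
    ∃ α : E ≃ₗᵢ[ℂ] F, ∀ i x, X' i (α x) = X i x := by
  have h0 : ∀ i n, X i (k n) = 0 := fun i n => (hk _).mp ⟨n, rfl⟩ i
  have h0' : ∀ i n, X' i (k' n) = 0 := fun i n => (hk' _).mp ⟨n, rfl⟩ i
  obtain ⟨α, hα⟩ := exists_linearIsometryEquiv_of_inner_eq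
    (eq_zero_of_inner_adjoint_of_inner_ker hk) (eq_zero_of_inner_adjoint_of_inner_ker hk') (by
      rintro (⟨i, g⟩ | n) (⟨j, h⟩ | m)
      · exact hX i j g h
      · simp [ContinuousLinearMap.adjoint_inner_left, h0, h0']
      · simp [ContinuousLinearMap.adjoint_inner_right, h0, h0']
      · simp)
  refine ⟨α, fun i x => ext_inner_left ℂ fun g => ?_⟩
  have h := hα (Sum.inl (i, g))
  simp only [Sum.elim_inl] at h
  rw [← ContinuousLinearMap.adjoint_inner_left, ← h, LinearIsometryEquiv.inner_map_map,
    ContinuousLinearMap.adjoint_inner_left]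

theorem HilbertBasis.eq_zero_of_inner (b : HilbertBasis ι ℂ E) (x : E)
    (hx : ∀ i, ⟪b i, x⟫_ℂ = 0) : x = 0 := by
  apply b.repr.injective
  ext i
  simp [b.repr_apply_apply, hx]

/-- The members of a Hilbert basis are more than `1` apart, so that there are only countably many in
a separable space. -/
theorem HilbertBasis.countable [TopologicalSpace.SeparableSpace E] (b : HilbertBasis ι ℂ E) :
    Countable ι := by
  have hd : ∀ i j, i ≠ j → 1 < dist (b i) (b j) := by
    intro i j hij
    have h := norm_sub_sq (𝕜 := ℂ) (b i) (b j)
    rw [b.orthonormal.2 hij, b.orthonormal.1 i, b.orthonormal.1 j] at h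
    rw [dist_eq_norm]
    norm_num at h
    nlinarith [norm_nonneg (b i - b j)]
  have := Set.PairwiseDisjoint.countable_of_isOpen (s := fun i => Metric.ball (b i) (1 / 2))
    (a := Set.univ) (fun i _ j _ hij => Metric.ball_disjoint_ball (by linarith [hd i j hij]))
    (fun i _ => Metric.isOpen_ball) (fun i _ => ⟨b i, by simp⟩)
  exact Set.countable_univ_iff.mp this

theorem HilbertBasis.exists_linearIsometry [CompleteSpace E] [CompleteSpace F]
    (b : HilbertBasis ι ℂ E) (c : HilbertBasis κ ℂ F) (f : ι ↪ κ) : Nonempty (E →ₗᵢ[ℂ] F) := by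
  classical
  obtain ⟨J, -⟩ := exists_linearIsometry_of_inner_eq (b := c ∘ f) b.eq_zero_of_inner fun i j => by
    simp [orthonormal_iff_ite.mp b.orthonormal, orthonormal_iff_ite.mp c.orthonormal]
  exact ⟨J⟩

theorem HilbertBasis.exists_linearIsometryEquiv [CompleteSpace E] [CompleteSpace F]
    (b : HilbertBasis ι ℂ E) (c : HilbertBasis κ ℂ F) (f : ι ≃ κ) : Nonempty (E ≃ₗᵢ[ℂ] F) := by
  classical
  obtain ⟨J, -⟩ := exists_linearIsometryEquiv_of_inner_eq (b := c ∘ f) b.eq_zero_of_inner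
    (fun x hx => c.eq_zero_of_inner x fun i => by simpa using hx (f.symm i)) fun i j => by
    simp [orthonormal_iff_ite.mp b.orthonormal, orthonormal_iff_ite.mp c.orthonormal]
  exact ⟨J⟩

theorem HilbertBasis.infinite (b : HilbertBasis ι ℂ E) (hE : ¬FiniteDimensional ℂ E) :
    Infinite ι := by
  refine not_finite_iff_infinite.mp fun hι => hE ?_
  have := Fintype.ofFinite ι
  exact b.toOrthonormalBasis.toBasis.finiteDimensional_of_finite

/-- Invariance of the Hilbert space dimension, in the separable case. -/
theorem HilbertBasis.nonempty_equiv [TopologicalSpace.SeparableSpace E]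
    (b : HilbertBasis ι ℂ E) (c : HilbertBasis κ ℂ E) : Nonempty (ι ≃ κ) := by
  have := b.countable
  have := c.countable
  by_cases hE : FiniteDimensional ℂ E
  · have : Finite ι := b.orthonormal.linearIndependent.finite
    have : Finite κ := c.orthonormal.linearIndependent.finite
    have := Fintype.ofFinite ι
    have := Fintype.ofFinite κ
    exact ⟨b.toOrthonormalBasis.toBasis.indexEquiv c.toOrthonormalBasis.toBasis⟩
  · have := b.infinite hE
    have := c.infinite hE
    exact nonempty_equiv_of_countable

/-- Of two Hilbert spaces, one embeds isometrically into the other. -/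
theorem exists_linearIsometry_or (E F : Type*) [NormedAddCommGroup E] [InnerProductSpace ℂ E]
    [CompleteSpace E] [NormedAddCommGroup F] [InnerProductSpace ℂ F] [CompleteSpace F] :
    Nonempty (E →ₗᵢ[ℂ] F) ∨ Nonempty (F →ₗᵢ[ℂ] E) := by
  obtain ⟨ι, b, -⟩ := exists_hilbertBasis ℂ E
  obtain ⟨κ, c, -⟩ := exists_hilbertBasis ℂ F
  rcases Function.Embedding.total ι κ with ⟨⟨f⟩⟩ | ⟨⟨f⟩⟩
  · exact Or.inl (b.exists_linearIsometry c f)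
  · exact Or.inr (c.exists_linearIsometry b f)

/-- A separable Hilbert space has a unitary copy in the lowest universe. -/
theorem exists_small_hilbert (E : Type*) [NormedAddCommGroup E] [InnerProductSpace ℂ E]
    [CompleteSpace E] [TopologicalSpace.SeparableSpace E] :
    ∃ (M : Type) (_ : NormedAddCommGroup M) (_ : InnerProductSpace ℂ M) (_ : CompleteSpace M)
      (_ : TopologicalSpace.SeparableSpace M), Nonempty (E ≃ₗᵢ[ℂ] M) := by
  obtain ⟨ι, b, -⟩ := exists_hilbertBasis ℂ E
  have := b.countable
  obtain ⟨f, hf⟩ := exists_injective_nat ι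
  let c : HilbertBasis (Set.range f) ℂ (lp (fun _ : Set.range f => ℂ) 2) :=
    HilbertBasis.ofRepr (LinearIsometryEquiv.refl ℂ _)
  obtain ⟨e⟩ := b.exists_linearIsometryEquiv c (Equiv.ofInjective f hf)
  exact ⟨_, inferInstance, inferInstance, inferInstance,
    e.surjective.denseRange.separableSpace e.continuous, ⟨e⟩⟩

/-- The codomain of an isometry splits as the orthogonal sum of its domain and a complement, and a
unitary copy of that complement exists in the lowest universe. -/
theorem LinearIsometry.exists_complement [CompleteSpace E] [CompleteSpace F]
    [TopologicalSpace.SeparableSpace F] (J : E →ₗᵢ[ℂ] F) :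
    ∃ (M : Type) (_ : NormedAddCommGroup M) (_ : InnerProductSpace ℂ M) (_ : CompleteSpace M)
      (_ : TopologicalSpace.SeparableSpace M), Nonempty (WithLp 2 (E × M) ≃ₗᵢ[ℂ] F) := by
  let R : Submodule ℂ F := LinearMap.range J.toLinearMap
  have : CompleteSpace R := J.isometry.isClosedEmbedding.isClosed_range.completeSpace_coe
  obtain ⟨M, i₁, i₂, i₃, i₄, ⟨e⟩⟩ := exists_small_hilbert Rᗮ
  exact ⟨M, i₁, i₂, i₃, i₄, ⟨(LinearIsometryEquiv.withLpProdCongr 2 J.equivRange e.symm).trans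
    R.orthogonalDecomposition.symm⟩⟩

end Hilbert

namespace DruryArveson

theorem exists_hilbertDim_eq (E : Type u) [NormedAddCommGroup E] [InnerProductSpace ℂ E]
    [CompleteSpace E] : ∃ (ι : Type u) (_ : HilbertBasis ι ℂ E), hilbertDim E = Cardinal.mk ι := by
  obtain ⟨b, -⟩ := (exists_hilbertBasis ℂ E).choose_spec
  exact ⟨_, b, rfl⟩

/-- The Hilbert space dimension is a complete unitary invariant of separable Hilbert spaces. -/
theorem lift_hilbertDim_eq_iff {E : Type u} [NormedAddCommGroup E] [InnerProductSpace ℂ E]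
    [CompleteSpace E] [TopologicalSpace.SeparableSpace E] {F : Type v} [NormedAddCommGroup F]
    [InnerProductSpace ℂ F] [CompleteSpace F] :
    Cardinal.lift.{v} (hilbertDim E) = Cardinal.lift.{u} (hilbertDim F) ↔
      Nonempty (E ≃ₗᵢ[ℂ] F) := by
  obtain ⟨ι, b, hb⟩ := exists_hilbertDim_eq E
  obtain ⟨κ, c, hc⟩ := exists_hilbertDim_eq F
  rw [hb, hc, Cardinal.lift_mk_eq']
  refine ⟨fun ⟨f⟩ => b.exists_linearIsometryEquiv c f, fun ⟨e⟩ => ?_⟩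
  exact b.nonempty_equiv (HilbertBasis.ofRepr (e.trans c.repr))

end DruryArveson

/-! ### Coefficient unitaries acting on function spaces -/

/-- Reproducing kernel Hilbert spaces whose kernels are intertwined by a unitary `β` of the
coefficient spaces are identified by `f ↦ β ∘ f`. -/
theorem RKHS.exists_linearIsometryEquiv_comp {X Y W H H' : Type*} [NormedAddCommGroup Y]
    [InnerProductSpace ℂ Y] [CompleteSpace Y] [NormedAddCommGroup W] [InnerProductSpace ℂ W]
    [CompleteSpace W] [NormedAddCommGroup H] [InnerProductSpace ℂ H] [CompleteSpace H]
    [NormedAddCommGroup H'] [InnerProductSpace ℂ H'] [CompleteSpace H'] [RKHS ℂ H X Y]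
    [RKHS ℂ H' X W] (β : Y ≃ₗᵢ[ℂ] W)
    (h : ∀ x x' v, RKHS.kernel H' x x' (β v) = β (RKHS.kernel H x x' v)) :
    ∃ Λ : H ≃ₗᵢ[ℂ] H', ∀ f x, Λ f x = β (f x) := by
  obtain ⟨Λ, hΛ⟩ := exists_linearIsometryEquiv_of_inner_eq
    (a := fun p : X × Y => RKHS.kerFun H p.1 p.2) (b := fun p : X × Y => RKHS.kerFun H' p.1 (β p.2))
    (fun f hf => RKHS.ext fun x => ext_inner_left ℂ fun v => by
      simpa using hf (x, v))
    (fun f hf => RKHS.ext fun x => ext_inner_left ℂ fun v => by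
      simpa using hf (x, β.symm v))
    (fun p q => by
      rw [RKHS.kerFun_inner, RKHS.kerFun_inner, RKHS.kerFun_apply, RKHS.kerFun_apply, h,
        LinearIsometryEquiv.inner_map_map])
  refine ⟨Λ, fun f x => ext_inner_left ℂ fun v => ?_⟩
  obtain ⟨v, rfl⟩ := β.surjective v
  rw [← RKHS.kerFun_inner, ← hΛ (x, v), LinearIsometryEquiv.inner_map_map, RKHS.kerFun_inner,
    LinearIsometryEquiv.inner_map_map]

namespace DruryArveson

section Transport

variable {d : ℕ} {U Y V W : Type*} [NormedAddCommGroup U] [InnerProductSpace ℂ U]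
  [CompleteSpace U] [NormedAddCommGroup Y] [InnerProductSpace ℂ Y] [CompleteSpace Y]
  [NormedAddCommGroup V] [InnerProductSpace ℂ V] [CompleteSpace V]
  [NormedAddCommGroup W] [InnerProductSpace ℂ W] [CompleteSpace W]

theorem exists_H2_comp (β : Y ≃ₗᵢ[ℂ] W) :
    ∃ Γ : H2 d Y ≃ₗᵢ[ℂ] H2 d W, ∀ f z, Γ f z = β (f z) := by
  refine RKHS.exists_linearIsometryEquiv_comp β fun z z' y => ?_
  rw [RKHS.OfKernel.kernel_ofKernel, RKHS.OfKernel.kernel_ofKernel]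
  simp [szegoKernel]

/-- The backward shifts of `H_d^2` commute with unitaries of the coefficient spaces. -/
theorem adjoint_coordMul_comp {β : Y ≃ₗᵢ[ℂ] W} {Γ : H2 d Y ≃ₗᵢ[ℂ] H2 d W}
    (hΓ : ∀ f z, Γ f z = β (f z)) (j : Fin d) (f : H2 d Y) :
    ContinuousLinearMap.adjoint (coordMul j) (Γ f) =
      Γ (ContinuousLinearMap.adjoint (coordMul j) f) := by
  refine ext_inner_left ℂ fun g => ?_
  obtain ⟨g, rfl⟩ := Γ.surjective g
  have h : coordMul j (Γ g) = Γ (coordMul j g) := RKHS.ext fun z => by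
    simp only [coordMul_apply, hΓ, map_smul]
  rw [ContinuousLinearMap.adjoint_inner_right, h, LinearIsometryEquiv.inner_map_map,
    LinearIsometryEquiv.inner_map_map, ContinuousLinearMap.adjoint_inner_right]

/-- The output unitary `β` of a coincidence `β φ(z) = ψ(z) α` intertwines the kernels, since
`φ(z) φ(w)^*` does not see `α`, and so identifies `H(k_φ)` with `H(k_ψ)`. -/
theorem SchurMultiplier.exists_space_comp {φ : SchurMultiplier d U Y} {ψ : SchurMultiplier d V W}
    {α : U ≃ₗᵢ[ℂ] V} {β : Y ≃ₗᵢ[ℂ] W} (h : ∀ (z : Ball d) (u : U), β (φ z u) = ψ z (α u)) :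
    ∃ Λ : φ.space ≃ₗᵢ[ℂ] ψ.space, ∀ f z, Λ f z = β (f z) := by
  refine RKHS.exists_linearIsometryEquiv_comp β fun z z' y => ?_
  have hadj : ContinuousLinearMap.adjoint (ψ z') (β y) =
      α (ContinuousLinearMap.adjoint (φ z') y) := by
    refine ext_inner_left ℂ fun u => ?_
    obtain ⟨u, rfl⟩ := α.surjective u
    rw [ContinuousLinearMap.adjoint_inner_right, ← h, LinearIsometryEquiv.inner_map_map,
      LinearIsometryEquiv.inner_map_map, ContinuousLinearMap.adjoint_inner_right]
  rw [RKHS.OfKernel.kernel_ofKernel, RKHS.OfKernel.kernel_ofKernel]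
  simp [SchurMultiplier.kernel, hadj, h]

theorem SchurMultiplier.Coincides.symm {φ : SchurMultiplier d U Y} {ψ : SchurMultiplier d V W}
    (h : φ.Coincides ψ) : ψ.Coincides φ := by
  obtain ⟨α, β, h⟩ := h
  exact ⟨α.symm, β.symm, fun z u => by rw [LinearIsometryEquiv.symm_apply_eq, h]; simp⟩

theorem SchurMultiplier.Coincides.nonempty_nullSpace_equiv {φ : SchurMultiplier d U Y}
    {ψ : SchurMultiplier d V W} (h : φ.Coincides ψ) :
    Nonempty (φ.nullSpace ≃ₗᵢ[ℂ] ψ.nullSpace) := by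
  obtain ⟨α, β, h⟩ := h
  have hmap : φ.nullSpace.map (α.toLinearEquiv : U →ₗ[ℂ] V) = ψ.nullSpace := by
    ext v
    obtain ⟨u, rfl⟩ := α.surjective v
    simp only [Submodule.mem_map, mem_nullSpace]
    constructor
    · rintro ⟨u', hu', he⟩ z
      rw [← α.injective he, ← h, hu', map_zero]
    · exact fun hu => ⟨u, fun z => β.injective (by rw [h, hu, map_zero]), rfl⟩
  exact ⟨(α.submoduleMap φ.nullSpace).trans (LinearIsometryEquiv.ofEq _ _ hmap)⟩

end Transport

/-! ### Colligations by columns, and their transfer functions -/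

namespace Colligation

section Blocks

variable {d : ℕ} {K U Y L V W M : Type*} [NormedAddCommGroup K] [InnerProductSpace ℂ K]
  [NormedAddCommGroup U] [InnerProductSpace ℂ U] [NormedAddCommGroup Y] [InnerProductSpace ℂ Y]
  [NormedAddCommGroup L] [InnerProductSpace ℂ L] [NormedAddCommGroup V] [InnerProductSpace ℂ V]
  [NormedAddCommGroup W] [InnerProductSpace ℂ W] [NormedAddCommGroup M] [InnerProductSpace ℂ M]

/-- The first column `(A, C) : K → K^d ⊕ Y` of the connecting operator. -/
noncomputable def stateOp (S : Colligation d K U Y) :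
    K →L[ℂ] WithLp 2 (PiLp 2 (fun _ : Fin d => K) × Y) :=
  (WithLp.prodContinuousLinearEquiv 2 ℂ (PiLp 2 (fun _ : Fin d => K)) Y).symm.toContinuousLinearMap
    ∘L S.A.prod S.C

/-- The second column `(B, D) : U → K^d ⊕ Y` of the connecting operator. -/
noncomputable def inputOp (S : Colligation d K U Y) :
    U →L[ℂ] WithLp 2 (PiLp 2 (fun _ : Fin d => K) × Y) :=
  (WithLp.prodContinuousLinearEquiv 2 ℂ (PiLp 2 (fun _ : Fin d => K)) Y).symm.toContinuousLinearMap
    ∘L S.B.prod S.D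

theorem stateOp_apply (S : Colligation d K U Y) (x : K) :
    S.stateOp x = WithLp.toLp 2 (S.A x, S.C x) := rfl

theorem inputOp_apply (S : Colligation d K U Y) (u : U) :
    S.inputOp u = WithLp.toLp 2 (S.B u, S.D u) := rfl

theorem inputOp_pad_apply (S : Colligation d K U Y) (p : WithLp 2 (U × M)) :
    (S.pad M).inputOp p = S.inputOp p.fst := rfl

theorem toCLM_apply (S : Colligation d K U Y) (p : WithLp 2 (K × U)) :
    S.toCLM p = S.stateOp p.fst + S.inputOp p.snd := rfl

/-- The unitary `Λ^d ⊕ Ω` of the output spaces. -/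
noncomputable def outputUnitary (d : ℕ) (Λ : K ≃ₗᵢ[ℂ] L) (Ω : Y ≃ₗᵢ[ℂ] W) :
    WithLp 2 (PiLp 2 (fun _ : Fin d => K) × Y) ≃ₗᵢ[ℂ] WithLp 2 (PiLp 2 (fun _ : Fin d => L) × W) :=
  LinearIsometryEquiv.withLpProdCongr 2
    (LinearIsometryEquiv.piLpCongrRight 2 fun _ : Fin d => Λ) Ω

theorem outputUnitary_toLp (Λ : K ≃ₗᵢ[ℂ] L) (Ω : Y ≃ₗᵢ[ℂ] W) (x : PiLp 2 (fun _ : Fin d => K))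
    (y : Y) : outputUnitary d Λ Ω (WithLp.toLp 2 (x, y)) =
      WithLp.toLp 2 (LinearIsometryEquiv.piLpCongrRight 2 (fun _ : Fin d => Λ) x, Ω y) := rfl

/-- Unitary coincidence, column by column. -/
theorem unitarilyCoincident_iff (S : Colligation d K U Y) (T : Colligation d L V W) :
    S.UnitarilyCoincident T ↔ ∃ (Λ : K ≃ₗᵢ[ℂ] L) (Ω₁ : U ≃ₗᵢ[ℂ] V) (Ω₂ : Y ≃ₗᵢ[ℂ] W),
      (∀ x, outputUnitary d Λ Ω₂ (S.stateOp x) = T.stateOp (Λ x)) ∧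
        ∀ u, outputUnitary d Λ Ω₂ (S.inputOp u) = T.inputOp (Ω₁ u) := by
  refine exists_congr fun Λ => exists_congr fun Ω₁ => exists_congr fun Ω₂ => ?_
  have key : (directSum (LinearIsometryEquiv.piLpCongrRight 2 (fun _ : Fin d => Λ) :
        PiLp 2 (fun _ : Fin d => K) →L[ℂ] PiLp 2 (fun _ : Fin d => L)) (Ω₂ : Y →L[ℂ] W) ∘L S.toCLM =
      T.toCLM ∘L directSum (Λ : K →L[ℂ] L) (Ω₁ : U →L[ℂ] V)) ↔
      ∀ x u, outputUnitary d Λ Ω₂ (S.stateOp x + S.inputOp u) =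
        T.stateOp (Λ x) + T.inputOp (Ω₁ u) :=
    ⟨fun h x u => DFunLike.congr_fun h (WithLp.toLp 2 (x, u)),
      fun h => ContinuousLinearMap.ext fun p => h p.fst p.snd⟩
  rw [key]
  constructor
  · exact fun h => ⟨fun x => by simpa using h x 0, fun u => by simpa using h 0 u⟩
  · rintro ⟨h₁, h₂⟩ x u
    rw [map_add, h₁, h₂]

/-- By `U U^* = I`, the Gram form of `inputOp^*` is determined by `stateOp`. -/
theorem IsCoisometric.inner_eq [CompleteSpace K] [CompleteSpace U] [CompleteSpace Y]
    {S : Colligation d K U Y} (hS : S.IsCoisometric)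
    (g h : WithLp 2 (PiLp 2 (fun _ : Fin d => K) × Y)) :
    ⟪ContinuousLinearMap.adjoint S.inputOp g, ContinuousLinearMap.adjoint S.inputOp h⟫_ℂ =
      ⟪g, h⟫_ℂ -
        ⟪ContinuousLinearMap.adjoint S.stateOp g, ContinuousLinearMap.adjoint S.stateOp h⟫_ℂ := by
  have hadj : ∀ g, ContinuousLinearMap.adjoint S.toCLM g = WithLp.toLp 2
      (ContinuousLinearMap.adjoint S.stateOp g, ContinuousLinearMap.adjoint S.inputOp g) := by
    intro g
    refine ext_inner_left ℂ fun p => ?_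
    rw [ContinuousLinearMap.adjoint_inner_right, toCLM_apply, inner_add_left,
      ← ContinuousLinearMap.adjoint_inner_right S.stateOp,
      ← ContinuousLinearMap.adjoint_inner_right S.inputOp]
    rfl
  have h1 : S.toCLM (ContinuousLinearMap.adjoint S.toCLM h) = h := DFunLike.congr_fun hS h
  have h2 : ⟪g, h⟫_ℂ =
      ⟪ContinuousLinearMap.adjoint S.toCLM g, ContinuousLinearMap.adjoint S.toCLM h⟫_ℂ := by
    rw [ContinuousLinearMap.adjoint_inner_left, h1]
  rw [h2, hadj, hadj, WithLp.prod_inner_apply]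
  ring

end Blocks

section TransferFunction

variable {d : ℕ} {K U Y L V W : Type*} [NormedAddCommGroup K] [InnerProductSpace ℂ K]
  [NormedAddCommGroup U] [InnerProductSpace ℂ U] [NormedAddCommGroup Y] [InnerProductSpace ℂ Y]
  [NormedAddCommGroup L] [InnerProductSpace ℂ L] [NormedAddCommGroup V] [InnerProductSpace ℂ V]
  [NormedAddCommGroup W] [InnerProductSpace ℂ W]

theorem Realizes.pad {S : Colligation d K U Y} {φ : Ball d → (U →L[ℂ] Y)} (h : S.Realizes φ)
    (M : Type*) [NormedAddCommGroup M] [InnerProductSpace ℂ M] :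
    (S.pad M).Realizes fun z => φ z ∘L WithLp.fstL 2 ℂ U M := fun z =>
  ⟨(h z).1, congrArg (· ∘L WithLp.fstL 2 ℂ U M) (h z).2⟩

theorem rowOp_piLpCongrRight (Λ : K ≃ₗᵢ[ℂ] L) (z : Ball d) (x : PiLp 2 (fun _ : Fin d => K)) :
    rowOp L z (LinearIsometryEquiv.piLpCongrRight 2 (fun _ : Fin d => Λ) x) =
      Λ (rowOp K z x) := by
  simp [rowOp]

theorem inverse_apply_of_intertwine {R : K →L[ℂ] K} {R' : L →L[ℂ] L} (hR : IsUnit R)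
    (hR' : IsUnit R') (Λ : K ≃ₗᵢ[ℂ] L) (h : ∀ x, R' (Λ x) = Λ (R x)) (x : K) :
    Ring.inverse R' (Λ x) = Λ (Ring.inverse R x) := by
  have h1 : R (Ring.inverse R x) = x := DFunLike.congr_fun (Ring.mul_inverse_cancel R hR) x
  have h2 : ∀ v, Ring.inverse R' (R' v) = v := DFunLike.congr_fun (Ring.inverse_mul_cancel R' hR')
  conv_lhs => rw [← h1, ← h, h2]

/-- Unitarily coincident colligations have coincident transfer functions. -/
theorem Realizes.apply_eq_of_coincident {S : Colligation d K U Y} {T : Colligation d L V W}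
    {φ : Ball d → (U →L[ℂ] Y)} {ψ : Ball d → (V →L[ℂ] W)} (hS : S.Realizes φ) (hT : T.Realizes ψ)
    {Λ : K ≃ₗᵢ[ℂ] L} {Ω₁ : U ≃ₗᵢ[ℂ] V} {Ω₂ : Y ≃ₗᵢ[ℂ] W}
    (hstate : ∀ x, outputUnitary d Λ Ω₂ (S.stateOp x) = T.stateOp (Λ x))
    (hinput : ∀ u, outputUnitary d Λ Ω₂ (S.inputOp u) = T.inputOp (Ω₁ u)) (z : Ball d) (u : U) :
    ψ z (Ω₁ u) = Ω₂ (φ z u) := by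
  have hA : ∀ x, T.A (Λ x) = LinearIsometryEquiv.piLpCongrRight 2 (fun _ : Fin d => Λ) (S.A x) :=
    fun x => congrArg WithLp.fst (hstate x).symm
  have hC : ∀ x, T.C (Λ x) = Ω₂ (S.C x) := fun x => congrArg WithLp.snd (hstate x).symm
  have hB : ∀ u, T.B (Ω₁ u) = LinearIsometryEquiv.piLpCongrRight 2 (fun _ : Fin d => Λ) (S.B u) :=
    fun u => congrArg WithLp.fst (hinput u).symm
  have hD : ∀ u, T.D (Ω₁ u) = Ω₂ (S.D u) := fun u => congrArg WithLp.snd (hinput u).symm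
  have hinv := inverse_apply_of_intertwine (hS z).1 (hT z).1 Λ fun x => by
    simp [hA, rowOp_piLpCongrRight, -LinearIsometryEquiv.piLpCongrRight_apply]
  rw [(hS z).2, (hT z).2]
  simp [hB, hD, hinv, hC, rowOp_piLpCongrRight, -LinearIsometryEquiv.piLpCongrRight_apply]

end TransferFunction

/-! ### Functional models and coincidence -/

section Model

variable {d : ℕ} {U Y V W : Type*} [NormedAddCommGroup U] [InnerProductSpace ℂ U]
  [CompleteSpace U] [NormedAddCommGroup Y] [InnerProductSpace ℂ Y] [CompleteSpace Y]
  [NormedAddCommGroup V] [InnerProductSpace ℂ V] [CompleteSpace V]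
  [NormedAddCommGroup W] [InnerProductSpace ℂ W] [CompleteSpace W]
  {φ : SchurMultiplier d U Y} {ψ : SchurMultiplier d V W}

theorem adjoint_comp_fstL {H M : Type*} [NormedAddCommGroup H] [InnerProductSpace ℂ H]
    [CompleteSpace H] [NormedAddCommGroup M] [InnerProductSpace ℂ M] [CompleteSpace M]
    (X : U →L[ℂ] H) (h : H) :
    ContinuousLinearMap.adjoint (X ∘L WithLp.fstL 2 ℂ U M) h =
      WithLp.toLp 2 (ContinuousLinearMap.adjoint X h, 0) := by
  refine ext_inner_left ℂ fun p => ?_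
  rw [ContinuousLinearMap.adjoint_inner_right, WithLp.prod_inner_apply]
  simp [ContinuousLinearMap.adjoint_inner_right]

/-- Padding the input space by `M` replaces `φ(z)` by `[φ(z), 0]`, which has the same products
`φ(z) φ(w)^*`. Hence functions realized by coincident colligations, one of them padded, can only
differ in the dimensions of their null spaces. -/
theorem coincides_of_pad_unitarilyCoincident {K L M : Type*} [NormedAddCommGroup K]
    [InnerProductSpace ℂ K] [NormedAddCommGroup L] [InnerProductSpace ℂ L] [NormedAddCommGroup M]
    [InnerProductSpace ℂ M] [CompleteSpace M] {S : Colligation d K U Y} {T : Colligation d L V W}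
    (hS : S.Realizes φ) (hT : T.Realizes ψ) (h : (S.pad M).UnitarilyCoincident T)
    (θ : φ.nullSpace ≃ₗᵢ[ℂ] ψ.nullSpace) : φ.Coincides ψ := by
  -- `Ω₁` itself does not settle the matter: `M` need not be zero when the null spaces are
  -- infinite-dimensional. It only serves to compare the products `φ(z) φ(w)^*` and `ψ(z) ψ(w)^*`.
  obtain ⟨Λ, Ω₁, Ω₂, hstate, hinput⟩ := (unitarilyCoincident_iff _ _).mp h
  have hpad := (hS.pad M).apply_eq_of_coincident hT hstate hinput
  let X : Ball d → U →L[ℂ] W := fun z => (Ω₂ : Y →L[ℂ] W) ∘L φ z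
  have hadj : ∀ z w, ContinuousLinearMap.adjoint (ψ z) w =
      Ω₁ (WithLp.toLp 2 (ContinuousLinearMap.adjoint (X z) w, 0)) := by
    intro z w
    rw [← adjoint_comp_fstL]
    refine ext_inner_left ℂ fun v => ?_
    obtain ⟨p, rfl⟩ := Ω₁.surjective v
    rw [LinearIsometryEquiv.inner_map_map, ContinuousLinearMap.adjoint_inner_right,
      ContinuousLinearMap.adjoint_inner_right, hpad]
    rfl
  obtain ⟨α, hα⟩ := exists_unitary_factor (X := X) (X' := fun z => ψ z)
    (k := φ.nullSpace.subtypeₗᵢ) (k' := ψ.nullSpace.subtypeₗᵢ.comp θ.toLinearIsometry)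
    (fun u => by simp [X, SchurMultiplier.mem_nullSpace])
    (fun v => by
      simp only [LinearIsometry.coe_comp, LinearIsometryEquiv.coe_toLinearIsometry,
        θ.surjective.range_comp]
      simp [SchurMultiplier.mem_nullSpace])
    (fun z z' g h => by
      rw [hadj, hadj, LinearIsometryEquiv.inner_map_map, WithLp.prod_inner_apply]
      simp)
  exact ⟨α, Ω₂, fun z u => (hα z u).symm⟩

/-- The first column of a functional model is determined by the function, hence transported by the
identification of the model spaces. -/
theorem IsFunctionalModel.stateOp_comp {S : Colligation d φ.space U Y}
    {T : Colligation d ψ.space V W} (hS : S.IsFunctionalModel φ) (hT : T.IsFunctionalModel ψ)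
    {β : Y ≃ₗᵢ[ℂ] W} {Λ : φ.space ≃ₗᵢ[ℂ] ψ.space} (hΛ : ∀ f z, Λ f z = β (f z)) (f : φ.space) :
    outputUnitary d Λ β (S.stateOp f) = T.stateOp (Λ f) := by
  obtain ⟨Γ, hΓ⟩ := exists_H2_comp (d := d) β
  rw [stateOp_apply, stateOp_apply, outputUnitary_toLp, hT.C_eq, hS.C_eq, hΛ]
  congr 2
  ext j z
  obtain ⟨F, hF, hSF⟩ := hS.A_eq j f
  obtain ⟨G, hG, hTG⟩ := hT.A_eq j (Λ f)
  have hGF : G = Γ F := RKHS.ext fun z => by rw [hG, hΓ, hF, hΛ]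
  rw [hTG, hGF, adjoint_coordMul_comp hΓ, hΓ, ← hSF, ← hΛ]
  rfl

/-- For a coisometry, `inputOp ∘ inputOp^* = 1 - stateOp ∘ stateOp^*`. Two coisometric colligations
with equivalent first columns therefore have second columns that differ by a unitary of the input
spaces, up to the dimensions of their kernels, and padding makes up for the latter. -/
theorem IsCoisometric.pad_unitarilyCoincident {K L M : Type*} [NormedAddCommGroup K]
    [InnerProductSpace ℂ K] [CompleteSpace K] [NormedAddCommGroup L] [InnerProductSpace ℂ L]
    [CompleteSpace L] [NormedAddCommGroup M] [InnerProductSpace ℂ M] [CompleteSpace M]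
    {S : Colligation d K U Y} {T : Colligation d L V W} (hS : S.IsCoisometric)
    (hT : T.IsCoisometric) {Λ : K ≃ₗᵢ[ℂ] L} {β : Y ≃ₗᵢ[ℂ] W}
    (hstate : ∀ x, outputUnitary d Λ β (S.stateOp x) = T.stateOp (Λ x))
    (θ : WithLp 2 (S.inputOp.ker × M) ≃ₗᵢ[ℂ] T.inputOp.ker) :
    (S.pad M).UnitarilyCoincident T := by
  set Ω := outputUnitary d Λ β
  have hadj : ∀ g, ContinuousLinearMap.adjoint T.stateOp (Ω g) =
      Λ (ContinuousLinearMap.adjoint S.stateOp g) := by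
    intro g
    refine ext_inner_left ℂ fun f => ?_
    obtain ⟨f, rfl⟩ := Λ.surjective f
    rw [LinearIsometryEquiv.inner_map_map, ContinuousLinearMap.adjoint_inner_right,
      ContinuousLinearMap.adjoint_inner_right, ← hstate, LinearIsometryEquiv.inner_map_map]
  let X : U →L[ℂ] WithLp 2 (PiLp 2 (fun _ : Fin d => L) × W) :=
    (Ω.toContinuousLinearEquiv : _ →L[ℂ] _) ∘L S.inputOp
  have hX : ∀ g, ContinuousLinearMap.adjoint X (Ω g) =
      ContinuousLinearMap.adjoint S.inputOp g := by
    intro g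
    refine ext_inner_left ℂ fun u => ?_
    rw [ContinuousLinearMap.adjoint_inner_right, ContinuousLinearMap.adjoint_inner_right]
    exact LinearIsometryEquiv.inner_map_map Ω _ _
  let k : WithLp 2 (S.inputOp.ker × M) →ₗᵢ[ℂ] WithLp 2 (U × M) :=
    { toFun := fun p => WithLp.toLp 2 ((p.fst : U), p.snd)
      map_add' := fun p q => rfl
      map_smul' := fun c p => rfl
      norm_map' := fun p => by
        rw [WithLp.prod_norm_eq_of_L2, WithLp.prod_norm_eq_of_L2]
        rfl }
  obtain ⟨Ω₁, hΩ₁⟩ := exists_unitary_factor (ι := Unit)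
    (X := fun _ => X ∘L WithLp.fstL 2 ℂ U M) (X' := fun _ => T.inputOp)
    (k := k) (k' := T.inputOp.ker.subtypeₗᵢ.comp θ.toLinearIsometry)
    (fun p => by
      have : X p.fst = 0 ↔ S.inputOp p.fst = 0 := Ω.map_eq_zero_iff
      simp only [forall_const, ContinuousLinearMap.comp_apply]
      refine Iff.trans ⟨?_, ?_⟩ this.symm
      · rintro ⟨q, rfl⟩
        exact q.fst.2
      · exact fun hp => ⟨WithLp.toLp 2 (⟨p.fst, hp⟩, p.snd), rfl⟩)
    (fun v => by
      simp only [LinearIsometry.coe_comp, LinearIsometryEquiv.coe_toLinearIsometry,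
        θ.surjective.range_comp]
      simp)
    (fun _ _ g h => by
      obtain ⟨g, rfl⟩ := Ω.surjective g
      obtain ⟨h, rfl⟩ := Ω.surjective h
      rw [adjoint_comp_fstL, adjoint_comp_fstL, hX, hX, WithLp.prod_inner_apply,
        hT.inner_eq, hadj, hadj, LinearIsometryEquiv.inner_map_map,
        LinearIsometryEquiv.inner_map_map, ← hS.inner_eq]
      simp)
  exact (unitarilyCoincident_iff _ _).mpr ⟨Λ, Ω₁, β, hstate, fun p => (hΩ₁ () p).symm⟩

theorem IsCoisometricFunctionalModel.exists_pad_unitarilyCoincident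
    [TopologicalSpace.SeparableSpace U] [TopologicalSpace.SeparableSpace V]
    {S : Colligation d φ.space U Y} {T : Colligation d ψ.space V W}
    (hS : S.IsCoisometricFunctionalModel φ) (hT : T.IsCoisometricFunctionalModel ψ)
    (h : φ.Coincides ψ) :
    ∃ (M : Type) (_ : NormedAddCommGroup M) (_ : InnerProductSpace ℂ M)
      (_ : CompleteSpace M) (_ : TopologicalSpace.SeparableSpace M),
      (S.pad M).UnitarilyCoincident T ∨ (T.pad M).UnitarilyCoincident S := by
  have : CompleteSpace S.inputOp.ker := S.inputOp.isClosed_ker.completeSpace_coe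
  have : CompleteSpace T.inputOp.ker := T.inputOp.isClosed_ker.completeSpace_coe
  rcases exists_linearIsometry_or S.inputOp.ker T.inputOp.ker with ⟨⟨J⟩⟩ | ⟨⟨J⟩⟩
  · obtain ⟨M, i₁, i₂, i₃, i₄, ⟨θ⟩⟩ := J.exists_complement
    obtain ⟨α, β, h⟩ := h
    obtain ⟨Λ, hΛ⟩ := SchurMultiplier.exists_space_comp h
    exact ⟨M, i₁, i₂, i₃, i₄, Or.inl (hS.coisometric.pad_unitarilyCoincident hT.coisometric
      (hS.toIsFunctionalModel.stateOp_comp hT.toIsFunctionalModel hΛ) θ)⟩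
  · obtain ⟨M, i₁, i₂, i₃, i₄, ⟨θ⟩⟩ := J.exists_complement
    obtain ⟨α, β, h⟩ := h.symm
    obtain ⟨Λ, hΛ⟩ := SchurMultiplier.exists_space_comp h
    exact ⟨M, i₁, i₂, i₃, i₄, Or.inr (hT.coisometric.pad_unitarilyCoincident hS.coisometric
      (hT.toIsFunctionalModel.stateOp_comp hS.toIsFunctionalModel hΛ) θ)⟩

end Model

end Colligation

end DruryArveson

theorem theorem3p2 {d : ℕ} {U : Type u} {V : Type v} {W : Type w} {Y : Type y}
    [NormedAddCommGroup U] [InnerProductSpace ℂ U] [CompleteSpace U]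
    [TopologicalSpace.SeparableSpace U]
    [NormedAddCommGroup Y] [InnerProductSpace ℂ Y] [CompleteSpace Y]
    [TopologicalSpace.SeparableSpace Y]
    [NormedAddCommGroup V] [InnerProductSpace ℂ V] [CompleteSpace V]
    [TopologicalSpace.SeparableSpace V]
    [NormedAddCommGroup W] [InnerProductSpace ℂ W] [CompleteSpace W]
    [TopologicalSpace.SeparableSpace W]
    (φ : DruryArveson.SchurMultiplier d U Y) (ψ : DruryArveson.SchurMultiplier d V W)
    (hφ : ∃ S : DruryArveson.Colligation d φ.space U Y, S.IsCoisometricFunctionalModel φ)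
    (hψ : ∃ T : DruryArveson.Colligation d ψ.space V W, T.IsCoisometricFunctionalModel ψ) :
    φ.Coincides ψ ↔
      Cardinal.lift.{v} (DruryArveson.hilbertDim φ.nullSpace) =
          Cardinal.lift.{u} (DruryArveson.hilbertDim ψ.nullSpace) ∧
        ∀ (S : DruryArveson.Colligation d φ.space U Y)
          (T : DruryArveson.Colligation d ψ.space V W),
          S.IsCoisometricFunctionalModel φ → T.IsCoisometricFunctionalModel ψ →
            ∃ (M : Type) (_ : NormedAddCommGroup M) (_ : InnerProductSpace ℂ M)
              (_ : CompleteSpace M) (_ : TopologicalSpace.SeparableSpace M),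
              (S.pad M).UnitarilyCoincident T ∨ (T.pad M).UnitarilyCoincident S := by
  rw [DruryArveson.lift_hilbertDim_eq_iff]
  refine ⟨fun h => ⟨h.nonempty_nullSpace_equiv, fun S T hS hT =>
    hS.exists_pad_unitarilyCoincident hT h⟩, ?_⟩
  rintro ⟨⟨θ⟩, h⟩
  obtain ⟨S, hS⟩ := hφ
  obtain ⟨T, hT⟩ := hψ
  obtain ⟨M, _, _, _, _, hM | hM⟩ := h S T hS hT
  · exact DruryArveson.Colligation.coincides_of_pad_unitarilyCoincident hS.realizes hT.realizes hM θ
  · exact (DruryArveson.Colligation.coincides_of_pad_unitarilyCoincident hT.realizes hS.realizes hM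
      θ.symm).symm
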